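/- Let $\mathcal H$ be a real Hilbert space, $N\ge 1$, $\mathcal Q\subset\mathcal H$ nonempty, closed and convex, $h:\mathcal H\to\mathbb R$ convex and differentiable with $\beta^{-1}$-Lipschitz gradient for some $\beta>0$, and let $f_1,\dots,f_N:\mathcal H\to\mathbb R$ be convex and lower semicontinuous. Write $N_C$ for the normal cone to a convex set $C$ (empty outside $C$), $\partial f$ for the convex subdifferential, $J_A=(\mathrm{Id}+A)^{-1}$ for the resolvent of $A$, $\rightharpoonup$ for weak convergence, and $e_1,\dots,e_N$ for the canonical basis of $\mathbb R^N$. Put $$P_1=\Big\{p\in\mathbb R^N:\sum_{i=1}^N p_i=1\Big\},\quad P_2=\{p\in\mathbb R^N: p\le q\},\quad P_3=\Big\{p\in\mathbb R^N:\mu_-\le\sum_{i=1}^N p_i\xi_i\le\mu_+\Big\},$$ where $q,\xi\in\mathbb R^N$ and $\mu_-,\mu_+\in\mathbb R$, and for $(x,p)\in\mathcal H\times\mathbb R^N$ define $$B_i(x,p)=p_i\,\partial f_i(x)\times\big(N_{[0,+\infty[}(p_i)-f_i(x)\big)e_i\quad(1\le i\le N),$$ $$A_1(x,p)=N_{\mathcal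 Q}(x)\times N_{P_1}(p),\qquad A_2(x,p)=\{0\}\times N_{P_2}(p),\qquad A_3(x,p)=\{0\}\times N_{P_3}(p).$$ For $m\in\{1,2\}$ let $\mathsf H_m=(\mathcal H\times\mathbb R^N)^{N+m}$, $V_m=\{z\in\mathsf H_m: z_1=\dots=z_{N+m}\}$, and $\widetilde C_m(z)=\big((\nabla h(x_1),0),0,\dots,0\big)$ for $z=((x_1,p_1),\dots,(x_{N+m},p_{N+m}))$. Let $\widetilde A_1=B_1\times\cdots\times B_N\times A_1$ on $\mathsf H_1$, and $\widetilde A_j=B_1\times\cdots\times B_N\times A_1\times A_j$ on $\mathsf H_2$ for $j\in\{2,3\}$. Consider the inclusions $$\text{(I}_1)\ \ 0\in\widetilde A_1(z)+\widetilde C_1(z)+N_{V_1}(z),\ z\in\mathsf H_1;\qquad \text{(I}_j)\ \ 0\in\widetilde A_j(z)+\widetilde C_2(z)+N_{V_2}(z),\ z\in\mathsf H_2\quad (j=2,3).$$ Let $\gamma\in\,]0,2\beta[$. **(a)** Assume that (I$_1$) has a solution. Let $z^0=((x_i^0,p_i^0))_{i=1}^{N+1}\in\mathsf H_1$ be arbitrary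 and, for every $k\in\mathbb N$, let $$\begin{aligned} &\bar z_i^k=(\bar x_i^k,\bar p_i^k)=\tfrac1{N+1}\textstyle\sum_{j=1}^{N+1}(x_j^k,p_j^k), && 1\le i\le N+1,\\ &(\tilde x_1^k,\tilde p_1^k)=J_{\gamma B_1}\big(2\bar x_1^k-x_1^k-\gamma\nabla h(\bar x_1^k),\,2\bar p_1^k-p_1^k\big),\\ &(\tilde x_i^k,\tilde p_i^k)=J_{\gamma B_i}\big(2\bar x_i^k-x_i^k,\,2\bar p_i^k-p_i^k\big), && 2\le i\le N,\\ &(\tilde x_{N+1}^k,\tilde p_{N+1}^k)=\big(\operatorname{proj}_{\mathcal Q}(2\bar x_{N+1}^k-x_{N+1}^k),\,\operatorname{proj}_{P_1}(2\bar p_{N+1}^k-p_{N+1}^k)\big),\\ &(x_i^{k+1},p_i^{k+1})=(x_i^k+\tilde x_i^k-\bar x_i^k,\;p_i^k+\tilde p_i^k-\bar p_i^k), && 1\le i\le N+1. \end{aligned}$$ Then there is a solution $z\in\mathsf H_1$ of (I$_1$) such that $\bar z^k\rightharpoonup z$. **(b)** Let $j\in\{2,3\}$ and assume that (I$_j$)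 has a solution. Let $z^0\in\mathsf H_2$ be arbitrary and consider the routine of (a) with $N+2$ blocks instead of $N+1$: the average $\frac1{N+2}\sum_{l=1}^{N+2}(x_l^k,p_l^k)$ and the last line are taken over $N+2$ blocks, blocks $1,\dots,N+1$ are otherwise processed as in (a), and $$(\tilde x_{N+2}^k,\tilde p_{N+2}^k)=\big(2\bar x_{N+2}^k-x_{N+2}^k,\ \operatorname{proj}_{P_j}(2\bar p_{N+2}^k-p_{N+2}^k)\big).$$ Then there is a solution $z\in\mathsf H_2$ of (I$_j$) such that $\bar z^k\rightharpoonup z$. -/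

import Mathlib

open Filter Topology
open scoped Pointwise

noncomputable section

namespace DRO

section General

variable {E : Type*} [NormedAddCommGroup E] [InnerProductSpace ℝ E]

/-- The convex subdifferential `∂f(x)` of a real-valued function. -/
def subdiff (f : E → ℝ) (x : E) : Set E :=
  {u | ∀ y, f x + inner ℝ u (y - x) ≤ f y}

/-- The normal cone `N_C(x)`; it is empty when `x ∉ C`. -/
def normalCone (C : Set E) (x : E) : Set E :=
  {u | x ∈ C ∧ ∀ y ∈ C, inner ℝ u (y - x) ≤ 0}

/-- The projection onto `C`: a point of `C` at minimal distance from `x`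
(it exists and is unique when `C` is nonempty, closed and convex in a Hilbert space). -/
def proj (C : Set E) (x : E) : E :=
  Classical.epsilon fun y => y ∈ C ∧ ∀ w ∈ C, ‖x - y‖ ≤ ‖x - w‖

/-- The resolvent `J_A(x) = (Id + A)⁻¹(x)` of a set-valued operator `A`: the point `y` such that
`x ∈ y + A(y)` (it exists and is unique when `A` is maximally monotone in a Hilbert space). -/
def res (A : E → Set E) (x : E) : E :=
  Classical.epsilon fun y => x ∈ {y} + A y

/-- Weak convergence of a sequence. -/
def WeakTendsto (u : ℕ → E) (l : E) : Prop :=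
  Tendsto (fun k => toWeakSpace ℝ E (u k)) atTop (𝓝 (toWeakSpace ℝ E l))

end General

/-- The Hilbert space `H × ℝ^N`. -/
abbrev Block (H : Type*) (N : ℕ) : Type _ := WithLp 2 (H × EuclideanSpace ℝ (Fin N))

/-- The Hilbert space `(H × ℝ^N)^m`. -/
abbrev ProdSpace (H : Type*) (N m : ℕ) : Type _ := PiLp 2 fun _ : Fin m => Block H N

variable {H : Type*} [NormedAddCommGroup H] [InnerProductSpace ℝ H] {N : ℕ}

/-- The element `(x, p)` of `H × ℝ^N`. -/
abbrev pair (x : H) (p : EuclideanSpace ℝ (Fin N)) : Block H N := WithLp.toLp 2 (x, p)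

/-- The hyperplane `P₁ = {p | ∑ pᵢ = 1}`. -/
def P₁ (N : ℕ) : Set (EuclideanSpace ℝ (Fin N)) := {p | ∑ i, p i = 1}

/-- The set `P₂ = {p | p ≤ q}`. -/
def P₂ (q : Fin N → ℝ) : Set (EuclideanSpace ℝ (Fin N)) := {p | ∀ i, p i ≤ q i}

/-- The set `P₃ = {p | μ₋ ≤ ∑ pᵢ ξᵢ ≤ μ₊}`. -/
def P₃ (ξ : Fin N → ℝ) (μm μp : ℝ) : Set (EuclideanSpace ℝ (Fin N)) :=
  {p | μm ≤ ∑ i, p i * ξ i ∧ ∑ i, p i * ξ i ≤ μp}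

/-- `Bᵢ(x, p) = pᵢ ∂fᵢ(x) × (N_{ℝ₊}(pᵢ) - fᵢ(x)) eᵢ`. -/
def B (f : Fin N → H → ℝ) (i : Fin N) (z : Block H N) : Set (Block H N) :=
  {w | ∃ u ∈ subdiff (f i) z.fst, ∃ v ∈ normalCone (Set.Ici (0 : ℝ)) (z.snd i),
    w = pair (z.snd i • u) (EuclideanSpace.single i (v - f i z.fst))}

/-- `A₁(x, p) = N_Q(x) × N_{P₁}(p)`. -/
def A₁ (Q : Set H) (z : Block H N) : Set (Block H N) :=
  {w | w.fst ∈ normalCone Q z.fst ∧ w.snd ∈ normalCone (P₁ N) z.snd}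

/-- `(x, p) ↦ {0} × N_P(p)`: the operator `A₂` for `P = P₂` and `A₃` for `P = P₃`. -/
def AP (P : Set (EuclideanSpace ℝ (Fin N))) (z : Block H N) : Set (Block H N) :=
  {w | w.fst = 0 ∧ w.snd ∈ normalCone P z.snd}

/-- `Ã₁ = B₁ × ⋯ × B_N × A₁`. -/
def prodA₁ (f : Fin N → H → ℝ) (Q : Set H) (z : ProdSpace H N (N + 1)) : Set (ProdSpace H N (N + 1)) :=
  {w | (∀ i : Fin N, w i.castSucc ∈ B f i (z i.castSucc)) ∧
    w (Fin.last N) ∈ A₁ Q (z (Fin.last N))}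

/-- `B₁ × ⋯ × B_N × A₁ × ({0} × N_P)`: `Ã₂` for `P = P₂` and `Ã₃` for `P = P₃`. -/
def prodAP (f : Fin N → H → ℝ) (Q : Set H) (P : Set (EuclideanSpace ℝ (Fin N)))
    (z : ProdSpace H N (N + 2)) : Set (ProdSpace H N (N + 2)) :=
  {w | (∀ i : Fin N, w i.castSucc.castSucc ∈ B f i (z i.castSucc.castSucc)) ∧
    w (Fin.last N).castSucc ∈ A₁ Q (z (Fin.last N).castSucc) ∧
    w (Fin.last (N + 1)) ∈ AP P (z (Fin.last (N + 1)))}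

/-- `C̃(z) = ((∇h(x₁), 0), 0, …, 0)` where `z = ((x₁, p₁), …)`. -/
def prodC [CompleteSpace H] (h : H → ℝ) (m : ℕ) (z : ProdSpace H N (m + 1)) : ProdSpace H N (m + 1) :=
  WithLp.toLp 2 fun i => if i = 0 then pair (gradient h (z 0).fst) 0 else 0

/-- The diagonal subspace `{z | z₁ = ⋯ = z_m}`. -/
def diag (H : Type*) (N m : ℕ) : Set (ProdSpace H N m) := {z | ∀ i j, z i = z j}

/-- `z` solves `0 ∈ Ã₁(z) + C̃₁(z) + N_{V₁}(z)`. -/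
def IsSol₁ [CompleteSpace H] (h : H → ℝ) (f : Fin N → H → ℝ) (Q : Set H)
    (z : ProdSpace H N (N + 1)) : Prop :=
  (0 : ProdSpace H N (N + 1)) ∈ prodA₁ f Q z + {prodC h N z} + normalCone (diag H N (N + 1)) z

/-- `z` solves `0 ∈ Ã(z) + C̃₂(z) + N_{V₂}(z)`, where `Ã = Ã₂` for `P = P₂` and
`Ã = Ã₃` for `P = P₃`. -/
def IsSolP [CompleteSpace H] (h : H → ℝ) (f : Fin N → H → ℝ) (Q : Set H)
    (P : Set (EuclideanSpace ℝ (Fin N))) (z : ProdSpace H N (N + 2)) : Prop :=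
  (0 : ProdSpace H N (N + 2)) ∈
    prodAP f Q P z + {prodC h (N + 1) z} + normalCone (diag H N (N + 2)) z

/-- The Davis–Yin routine in `(H × ℝ^N)^(N+1)`, with `z k i = (xᵢᵏ, pᵢᵏ)`,
`zb k i = (x̄ᵢᵏ, p̄ᵢᵏ)` and `zt k i = (x̃ᵢᵏ, p̃ᵢᵏ)`. The starting point `z 0` is arbitrary. -/
structure IsDavisYin₁ [CompleteSpace H] (h : H → ℝ) (f : Fin N → H → ℝ) (Q : Set H) (γ : ℝ)
    (z zb zt : ℕ → ProdSpace H N (N + 1)) : Prop where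
  average : ∀ k i, zb k i = (1 / ((N : ℝ) + 1)) • ∑ j, z k j
  first : ∀ k, ∀ i : Fin N, i.val = 0 → zt k i.castSucc = res (γ • B f i)
    (pair ((2 : ℝ) • (zb k i.castSucc).fst - (z k i.castSucc).fst
        - γ • gradient h (zb k i.castSucc).fst)
      ((2 : ℝ) • (zb k i.castSucc).snd - (z k i.castSucc).snd))
  middle : ∀ k, ∀ i : Fin N, i.val ≠ 0 → zt k i.castSucc = res (γ • B f i)
    (pair ((2 : ℝ) • (zb k i.castSucc).fst - (z k i.castSucc).fst)
      ((2 : ℝ) • (zb k i.castSucc).snd - (z k i.castSucc).snd))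
  last : ∀ k, zt k (Fin.last N) =
    pair (proj Q ((2 : ℝ) • (zb k (Fin.last N)).fst - (z k (Fin.last N)).fst))
      (proj (P₁ N) ((2 : ℝ) • (zb k (Fin.last N)).snd - (z k (Fin.last N)).snd))
  update : ∀ k i, z (k + 1) i = z k i + zt k i - zb k i

/-- The Davis–Yin routine in `(H × ℝ^N)^(N+2)`; the last block uses the projection onto `P`. -/
structure IsDavisYinP [CompleteSpace H] (h : H → ℝ) (f : Fin N → H → ℝ) (Q : Set H)
    (P : Set (EuclideanSpace ℝ (Fin N))) (γ : ℝ) (z zb zt : ℕ → ProdSpace H N (N + 2)) : Prop where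
  average : ∀ k i, zb k i = (1 / ((N : ℝ) + 2)) • ∑ j, z k j
  first : ∀ k, ∀ i : Fin N, i.val = 0 → zt k i.castSucc.castSucc = res (γ • B f i)
    (pair ((2 : ℝ) • (zb k i.castSucc.castSucc).fst - (z k i.castSucc.castSucc).fst
        - γ • gradient h (zb k i.castSucc.castSucc).fst)
      ((2 : ℝ) • (zb k i.castSucc.castSucc).snd - (z k i.castSucc.castSucc).snd))
  middle : ∀ k, ∀ i : Fin N, i.val ≠ 0 → zt k i.castSucc.castSucc = res (γ • B f i)
    (pair ((2 : ℝ) • (zb k i.castSucc.castSucc).fst - (z k i.castSucc.castSucc).fst)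
      ((2 : ℝ) • (zb k i.castSucc.castSucc).snd - (z k i.castSucc.castSucc).snd))
  penultimate : ∀ k, zt k (Fin.last N).castSucc =
    pair (proj Q ((2 : ℝ) • (zb k (Fin.last N).castSucc).fst - (z k (Fin.last N).castSucc).fst))
      (proj (P₁ N)
        ((2 : ℝ) • (zb k (Fin.last N).castSucc).snd - (z k (Fin.last N).castSucc).snd))
  last : ∀ k, zt k (Fin.last (N + 1)) =
    pair ((2 : ℝ) • (zb k (Fin.last (N + 1))).fst - (z k (Fin.last (N + 1))).fst)
      (proj P ((2 : ℝ) • (zb k (Fin.last (N + 1))).snd - (z k (Fin.last (N + 1))).snd))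
  update : ∀ k i, z (k + 1) i = z k i + zt k i - zb k i

end DRO

end

/-! Each inclusion has the form 0 ∈ A x + C x + N_V x with V the diagonal, so the routine is
Davis–Yin splitting: with P the projection onto V (block averaging) and R = 2P - Id - γ C P, the
iteration is z ↦ T z = z + J_{γA}(R z) - P z. Three facts about the operators are needed: A is
monotone, Id + γA is surjective, and C is β-cocoercive. Cocoercivity is the Baillon–Haddad theorem
(`gradient_cocoercive`), applied in the first block.

Given these, `davisYin_inequality` shows that T is averaged, with constant 1 - γ/(2β) > 0. A fixed
point w of T projects to a solution P w, and a solution x with a ∈ A x yields the fixed point x -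
γ(a + C x). Hence the iterates are Fejér monotone and their residuals vanish; demiclosedness and
Opial's lemma give a weak limit fixed by T, and the projections converge weakly because P is linear
and self-adjoint.

The specific point is B_i, which is not a subdifferential but the operator of the saddle function
p_i f_i(x) on p_i ≥ 0. Its monotonicity is a cancellation of cross terms (`isMonotone_B`). For its
resolvent, the p-inclusion forces p = max(0, b + γ f(x)); substituting it turns the x-inclusion into
the optimality condition of a convex minimization (`exists_saddle_resolvent`). Thus no general
maximality theorem is needed. -/

namespace DRO

/-! ### Weak compactness, Opial's lemma and averaged operators -/

section WeakConvergence

variable {E : Type*} [NormedAddCommGroup E] [InnerProductSpace ℝ E]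

/-- By Riesz representation every continuous functional is an inner product, so testing against
vectors suffices. -/
theorem weakTendsto_of_forall_inner [CompleteSpace E] {u : ℕ → E} {l : E}
    (h : ∀ y, Tendsto (fun k => inner ℝ (u k) y) atTop (𝓝 (inner ℝ l y))) : WeakTendsto u l := by
  have hinj : Function.Injective (topDualPairing ℝ E).flip := by
    intro x y hxy
    refine ext_inner_left ℝ fun v => ?_
    exact DFunLike.congr_fun hxy (InnerProductSpace.toDual ℝ E v)
  refine (WeakBilin.tendsto_iff_forall_eval_tendsto _ hinj).2 fun φ => ?_
  have hφ : ∀ x : E, (topDualPairing ℝ E).flip x φ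
      = inner ℝ x ((InnerProductSpace.toDual ℝ E).symm φ) := by
    intro x
    rw [real_inner_comm, InnerProductSpace.toDual_symm_apply]
    rfl
  have := h ((InnerProductSpace.toDual ℝ E).symm φ)
  simp only [← hφ] at this
  exact this

/-- Banach–Alaoglu transported through the Riesz isometry. Ultrafilters play the role of
subsequences, so separability is not required. -/
theorem exists_weak_limit_ultrafilter [CompleteSpace E] {ι : Type*} (U : Ultrafilter ι) {u : ι → E} {R : ℝ}
    (hu : ∀ k, ‖u k‖ ≤ R) :
    ∃ l, ∀ y, Tendsto (fun k => inner ℝ (u k) y) U (𝓝 (inner ℝ l y)) := by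
  let g : ι → WeakDual ℝ E := fun k => StrongDual.toWeakDual (InnerProductSpace.toDual ℝ E (u k))
  have hc := WeakDual.isCompact_closedBall (𝕜 := ℝ) (0 : StrongDual ℝ E) R
  have hmem : ∀ k, g k ∈ WeakDual.toStrongDual ⁻¹' Metric.closedBall (0 : StrongDual ℝ E) R := by
    intro k
    simpa [g] using hu k
  obtain ⟨φ, -, hφ⟩ := hc.ultrafilter_le_nhds (U.map g)
    (le_principal_iff.2 (Filter.mem_map.2 (Filter.univ_mem' hmem)))
  refine ⟨(InnerProductSpace.toDual ℝ E).symm (WeakDual.toStrongDual φ), fun y => ?_⟩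
  rw [InnerProductSpace.toDual_symm_apply]
  exact ((WeakDual.eval_continuous y).tendsto φ).comp hφ

/-- Opial's lemma for Fejér monotone sequences. -/
theorem exists_weak_limit_of_fejer [CompleteSpace E] {u : ℕ → E} {F : Set E} (hne : F.Nonempty)
    (hfejer : ∀ w ∈ F, ∀ k, ‖u (k + 1) - w‖ ≤ ‖u k - w‖)
    (hcluster : ∀ U : Ultrafilter ℕ, (U : Filter ℕ) ≤ atTop → ∀ l,
      (∀ y, Tendsto (fun k => inner ℝ (u k) y) U (𝓝 (inner ℝ l y))) → l ∈ F) :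
    ∃ l ∈ F, ∀ y, Tendsto (fun k => inner ℝ (u k) y) atTop (𝓝 (inner ℝ l y)) := by
  have hanti : ∀ w ∈ F, Antitone fun k => ‖u k - w‖ := fun w hw =>
    antitone_nat_of_succ_le (hfejer w hw)
  obtain ⟨w₀, hw₀⟩ := hne
  have hbdd : ∀ k, ‖u k‖ ≤ ‖u 0 - w₀‖ + ‖w₀‖ := fun k => by
    calc ‖u k‖ = ‖(u k - w₀) + w₀‖ := by simp
      _ ≤ ‖u k - w₀‖ + ‖w₀‖ := norm_add_le _ _
      _ ≤ _ := by gcongr; exact hanti w₀ hw₀ (Nat.zero_le k)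
  have hlim : ∀ w ∈ F, ∃ c, Tendsto (fun k => ‖u k - w‖) atTop (𝓝 c) := fun w hw =>
    ⟨_, tendsto_atTop_ciInf (hanti w hw) ⟨0, by rintro _ ⟨k, rfl⟩; positivity⟩⟩
  -- One ultrafilter finer than `atTop` provides the candidate limit; it remains to show that every
  -- other such ultrafilter gives the same one.
  obtain ⟨l, hl⟩ := exists_weak_limit_ultrafilter (Ultrafilter.of atTop) hbdd
  have hlF := hcluster _ (Ultrafilter.of_le atTop) l hl
  refine ⟨l, hlF, fun y => (tendsto_iff_ultrafilter _ _ _).2 fun U hU => ?_⟩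
  obtain ⟨l', hl'⟩ := exists_weak_limit_ultrafilter U hbdd
  have hl'F := hcluster U hU l' hl'
  suffices l = l' by
    rw [this]
    exact hl' y
  obtain ⟨c, hc⟩ := hlim l hlF
  obtain ⟨c', hc'⟩ := hlim l' hl'F
  -- Distances to l and to l' both converge, so the difference of their squares, which is affine in
  -- `u k`, makes the inner product with l - l' converge along the whole sequence.
  have hdiff : Tendsto (fun k => inner ℝ (u k) (l - l')) atTop
      (𝓝 (-(1 / 2) * (c ^ 2 - c' ^ 2 - ‖l‖ ^ 2 + ‖l'‖ ^ 2))) := by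
    have := ((((hc.pow 2).sub (hc'.pow 2)).sub_const (‖l‖ ^ 2)).add_const (‖l'‖ ^ 2)).const_mul
      (-(1 / 2) : ℝ)
    refine this.congr fun k => ?_
    rw [norm_sub_sq_real, norm_sub_sq_real, inner_sub_right]
    ring
  have h1 := tendsto_nhds_unique (hl (l - l')) (hdiff.mono_left (Ultrafilter.of_le atTop))
  have h2 := tendsto_nhds_unique (hl' (l - l')) (hdiff.mono_left hU)
  have h3 : inner ℝ (l - l') (l - l') = 0 := by rw [inner_sub_left, h1, h2, sub_self]
  exact sub_eq_zero.1 (inner_self_eq_zero.1 h3)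

/-- The demiclosedness principle for nonexpansive maps. -/
theorem fixed_of_weak_limit {T : E → E} (hT : ∀ x y, ‖T x - T y‖ ≤ ‖x - y‖) {U : Ultrafilter ℕ}
    {u : ℕ → E} {R : ℝ} (hu : ∀ k, ‖u k‖ ≤ R)
    (hd : Tendsto (fun k => ‖u k - T (u k)‖) U (𝓝 0)) {l : E}
    (hl : ∀ y, Tendsto (fun k => inner ℝ (u k) y) U (𝓝 (inner ℝ l y))) : T l = l := by
  -- Compare two estimates of ‖u_k - T l‖²: the triangle inequality with nonexpansiveness, and the
  -- expansion around l, whose cross term vanishes in the weak limit.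
  have hbound : ∀ k, ‖l - T l‖ ^ 2 ≤ ‖u k - T (u k)‖ ^ 2
      + 2 * (R + ‖l‖) * ‖u k - T (u k)‖ - 2 * (inner ℝ (u k) (l - T l) - inner ℝ l (l - T l)) := by
    intro k
    have e : u k - T l = (u k - l) + (l - T l) := by abel
    have h1 : ‖u k - T l‖ ≤ ‖u k - T (u k)‖ + ‖u k - l‖ := by
      calc ‖u k - T l‖ = ‖(u k - T (u k)) + (T (u k) - T l)‖ := by congr 1; abel
        _ ≤ ‖u k - T (u k)‖ + ‖T (u k) - T l‖ := norm_add_le _ _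
        _ ≤ _ := by gcongr; exact hT _ _
    have h2 : ‖u k - l‖ ≤ R + ‖l‖ := (norm_sub_le _ _).trans (by gcongr; exact hu k)
    have h3 : ‖u k - T l‖ ^ 2
        = ‖u k - l‖ ^ 2 + 2 * (inner ℝ (u k) (l - T l) - inner ℝ l (l - T l)) + ‖l - T l‖ ^ 2 := by
      rw [e, norm_add_sq_real, inner_sub_left]
    have h4 : ‖u k - T l‖ ^ 2 ≤ (‖u k - T (u k)‖ + ‖u k - l‖) ^ 2 := by gcongr
    have h5 : ‖u k - T (u k)‖ * ‖u k - l‖ ≤ ‖u k - T (u k)‖ * (R + ‖l‖) := by gcongr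
    nlinarith
  have hlim := ((hd.pow 2).add (hd.const_mul (2 * (R + ‖l‖)))).sub
    (((hl (l - T l)).sub_const (inner ℝ l (l - T l))).const_mul 2)
  have h0 : ‖l - T l‖ ^ 2 ≤ 0 := by
    have := ge_of_tendsto' hlim hbound
    simpa using this
  have h6 : ‖l - T l‖ = 0 := by
    have := sq_nonneg ‖l - T l‖
    exact pow_eq_zero_iff (two_ne_zero) |>.1 (le_antisymm h0 this)
  exact (sub_eq_zero.1 (norm_eq_zero.1 h6)).symm

/-- Weak convergence of the iterates of an averaged operator. -/
theorem exists_weak_limit_of_averaged [CompleteSpace E] {T : E → E} {c : ℝ} (hc : 0 < c)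
    (hT : ∀ x y, ‖T x - T y‖ ^ 2 + c * ‖(x - T x) - (y - T y)‖ ^ 2 ≤ ‖x - y‖ ^ 2)
    (hfix : ∃ w, T w = w) {u : ℕ → E} (hu : ∀ k, u (k + 1) = T (u k)) :
    ∃ l, T l = l ∧ ∀ y, Tendsto (fun k => inner ℝ (u k) y) atTop (𝓝 (inner ℝ l y)) := by
  have hne : ∀ x y, ‖T x - T y‖ ≤ ‖x - y‖ := fun x y => by
    refine abs_le_of_sq_le_sq' ?_ (norm_nonneg _) |>.2
    have := hT x y
    have : 0 ≤ c * ‖(x - T x) - (y - T y)‖ ^ 2 := by positivity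
    linarith
  have hfejer : ∀ w, T w = w → ∀ k, ‖u (k + 1) - w‖ ≤ ‖u k - w‖ := fun w hw k => by
    have := hne (u k) w
    rwa [hw, ← hu] at this
  obtain ⟨w, hw⟩ := hfix
  have hanti : Antitone fun k => ‖u k - w‖ := antitone_nat_of_succ_le (hfejer w hw)
  have hbdd : ∀ k, ‖u k‖ ≤ ‖u 0 - w‖ + ‖w‖ := fun k => by
    calc ‖u k‖ = ‖(u k - w) + w‖ := by simp
      _ ≤ ‖u k - w‖ + ‖w‖ := norm_add_le _ _
      _ ≤ _ := by gcongr; exact hanti (Nat.zero_le k)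
  obtain ⟨a, ha⟩ : ∃ a, Tendsto (fun k => ‖u k - w‖) atTop (𝓝 a) :=
    ⟨_, tendsto_atTop_ciInf hanti ⟨0, by rintro _ ⟨k, rfl⟩; positivity⟩⟩
  have hd : Tendsto (fun k => ‖u k - T (u k)‖) atTop (𝓝 0) := by
    have h1 : Tendsto (fun k => c⁻¹ * (‖u k - w‖ ^ 2 - ‖u (k + 1) - w‖ ^ 2)) atTop (𝓝 0) := by
      have := (((ha.pow 2).sub (((tendsto_add_atTop_iff_nat 1).2 ha).pow 2)).const_mul c⁻¹)
      simpa using this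
    have h2 : Tendsto (fun k => ‖u k - T (u k)‖ ^ 2) atTop (𝓝 0) := by
      refine squeeze_zero (fun k => by positivity) (fun k => ?_) h1
      have := hT (u k) w
      rw [hw, sub_self, sub_zero, ← hu] at this
      rw [hu k, ← hu, inv_mul_eq_div, le_div_iff₀ hc]
      linarith
    have := h2.sqrt
    simpa using this
  obtain ⟨l, hl, hlim⟩ := exists_weak_limit_of_fejer (F := {w | T w = w}) ⟨w, hw⟩
    (fun w hw => hfejer w hw) fun U hU l hl =>
      fixed_of_weak_limit hne hbdd (hd.mono_left hU) hl
  exact ⟨l, hl, hlim⟩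

end WeakConvergence

/-! ### Davis–Yin splitting with a subspace -/

section DavisYin

variable {E : Type*} [NormedAddCommGroup E] [InnerProductSpace ℝ E]

/-- Monotonicity of a set-valued operator. -/
def IsMonotone (A : E → Set E) : Prop :=
  ∀ x y, ∀ u ∈ A x, ∀ v ∈ A y, 0 ≤ inner ℝ (u - v) (x - y)

theorem IsMonotone.resolvent_unique {A : E → Set E} (hA : IsMonotone A) {γ : ℝ} (hγ : 0 < γ)
    {x y y' : E} (h : γ⁻¹ • (x - y) ∈ A y) (h' : γ⁻¹ • (x - y') ∈ A y') : y = y' := by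
  have h1 := hA _ _ _ h _ h'
  have e : γ⁻¹ • (x - y) - γ⁻¹ • (x - y') = -(γ⁻¹ • (y - y')) := by
    rw [← smul_sub, ← smul_neg]
    congr 1
    abel
  rw [e, inner_neg_left, inner_smul_left, real_inner_self_eq_norm_sq] at h1
  simp only [conj_trivial] at h1
  have h2 : 0 < γ⁻¹ := inv_pos.2 hγ
  have h3 : ‖y - y'‖ ^ 2 ≤ 0 := by
    by_contra hcon
    push Not at hcon
    have := mul_pos h2 hcon
    linarith
  have h4 : ‖y - y'‖ = 0 := by
    have := sq_nonneg ‖y - y'‖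
    exact pow_eq_zero_iff two_ne_zero |>.1 (le_antisymm h3 this)
  exact sub_eq_zero.1 (norm_eq_zero.1 h4)

/-- The key inequality of the Davis–Yin splitting, for differences of iterates: `b` lies in the
subspace part, `z - b` in its orthogonal complement, `a` is the resolvent step. -/
theorem davisYin_inequality {z b a c : E} {γ β : ℝ} (hγ : 0 < γ) (hβ : 0 < β)
    (hb : inner ℝ (z - b) b = 0)
    (ha : 0 ≤ inner ℝ ((2 : ℝ) • b - z - γ • c - a) a)
    (hc : β * ‖c‖ ^ 2 ≤ inner ℝ c b) :
    ‖z + a - b‖ ^ 2 + (1 - γ / (2 * β)) * ‖b - a‖ ^ 2 ≤ ‖z‖ ^ 2 := by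
  obtain ⟨d, rfl⟩ : ∃ d, a = b - d := ⟨b - a, by abel⟩
  obtain ⟨w, rfl⟩ : ∃ w, z = w + b := ⟨z - b, by abel⟩
  have e1 : w + b + (b - d) - b = (w + b) - d := by abel
  have e2 : (2 : ℝ) • b - (w + b) - γ • c - (b - d) = d - w - γ • c := by
    rw [two_smul]; abel
  have e3 : w + b - b = w := by abel
  have e4 : b - (b - d) = d := by abel
  rw [e3] at hb
  rw [e2] at ha
  rw [e1, e4, norm_sub_sq_real (w + b) d, inner_add_left]
  simp only [inner_sub_left, inner_sub_right, inner_smul_left, conj_trivial,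
    real_inner_self_eq_norm_sq] at ha
  -- Young's inequality, weighted so that the ‖c‖² term is exactly what cocoercivity absorbs; the
  -- rest is the loss γ/(2β) in the averaging constant.
  have hy : 2 * γ * inner ℝ c d ≤ 2 * γ * β * ‖c‖ ^ 2 + γ / (2 * β) * ‖d‖ ^ 2 := by
    have h := sq_nonneg ‖(2 * β) • c - d‖
    rw [norm_sub_sq_real, norm_smul, inner_smul_left, Real.norm_of_nonneg (by positivity)] at h
    simp only [conj_trivial] at h
    have h2 : 0 ≤ γ / (2 * β) * ((2 * β * ‖c‖) ^ 2 - 2 * (2 * β * inner ℝ c d) + ‖d‖ ^ 2) := by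
      positivity
    have h3 : γ / (2 * β) * ((2 * β * ‖c‖) ^ 2 - 2 * (2 * β * inner ℝ c d) + ‖d‖ ^ 2)
        = 2 * γ * β * ‖c‖ ^ 2 - 2 * γ * inner ℝ c d + γ / (2 * β) * ‖d‖ ^ 2 := by
      field_simp
    linarith
  have hc' := mul_le_mul_of_nonneg_left hc hγ.le
  rw [real_inner_comm b d] at ha
  linarith

/-- Weak convergence of Davis–Yin splitting for `0 ∈ A x + C x + N_V x` with `V` a subspace. -/
theorem exists_weak_limit_davisYin [CompleteSpace E] {A : E → Set E} (hA : IsMonotone A)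
    {C : E → E} {β γ : ℝ} (hβ : 0 < β) (hγ : γ ∈ Set.Ioo 0 (2 * β))
    (hC : ∀ x y, β * ‖C x - C y‖ ^ 2 ≤ inner ℝ (C x - C y) (x - y))
    (V : Submodule ℝ E) [V.HasOrthogonalProjection]
    (hres : ∀ x, ∃ y, γ⁻¹ • (x - y) ∈ A y)
    (hsol : ∃ x ∈ V, ∃ a ∈ A x, a + C x ∈ Vᗮ)
    {z zt : ℕ → E}
    (hzt : ∀ k, γ⁻¹ • ((2 : ℝ) • V.starProjection (z k) - z k - γ • C (V.starProjection (z k))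
      - zt k) ∈ A (zt k))
    (hz : ∀ k, z (k + 1) = z k + zt k - V.starProjection (z k)) :
    ∃ x ∈ V, (∃ a ∈ A x, a + C x ∈ Vᗮ) ∧ WeakTendsto (fun k => V.starProjection (z k)) x := by
  have hγ0 := hγ.1
  choose J hJ using hres
  set P := V.starProjection with hP
  let R : E → E := fun x => (2 : ℝ) • P x - x - γ • C (P x)
  let T : E → E := fun x => x + J (R x) - P x
  have hT : ∀ x y, ‖T x - T y‖ ^ 2 + (1 - γ / (2 * β)) * ‖(x - T x) - (y - T y)‖ ^ 2
      ≤ ‖x - y‖ ^ 2 := by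
    intro x y
    have h := davisYin_inequality (z := x - y) (b := P x - P y) (a := J (R x) - J (R y))
      (c := C (P x) - C (P y)) hγ0 hβ ?_ ?_ (hC _ _)
    · have e1 : T x - T y = x - y + (J (R x) - J (R y)) - (P x - P y) := by
        simp only [T]; abel
      have e2 : (x - T x) - (y - T y) = P x - P y - (J (R x) - J (R y)) := by
        simp only [T]; abel
      rw [e1, e2]
      exact h
    · rw [← map_sub]
      exact Submodule.starProjection_inner_eq_zero _ _ (Submodule.starProjection_apply_mem _ _)
    · have h1 := hA _ _ _ (hJ (R x)) _ (hJ (R y))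
      rw [← smul_sub, inner_smul_left] at h1
      simp only [conj_trivial] at h1
      have h2 := nonneg_of_mul_nonneg_right h1 (inv_pos.2 hγ0)
      have e : (2 : ℝ) • (P x - P y) - (x - y) - γ • (C (P x) - C (P y)) - (J (R x) - J (R y))
          = R x - J (R x) - (R y - J (R y)) := by
        simp only [R, smul_sub]
        abel
      rwa [e]
  have hc : 0 < 1 - γ / (2 * β) := by
    rw [sub_pos, div_lt_one (by positivity)]
    exact hγ.2
  have hfix : ∃ w, T w = w := by
    obtain ⟨x, hx, a, ha, hax⟩ := hsol
    -- The correction γ(a + C x) is orthogonal to V, so P returns x; then R gives x + γ a, whose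
    -- resolvent is again x.
    have hPw : P (x - γ • (a + C x)) = x := by
      refine Submodule.eq_starProjection_of_mem_orthogonal hx ?_
      rw [sub_sub_cancel_left, ← smul_neg]
      exact Vᗮ.smul_mem _ (Vᗮ.neg_mem hax)
    have hRw : R (x - γ • (a + C x)) = x + γ • a := by
      simp only [R]
      rw [hPw, two_smul, smul_add]
      abel
    have hJw : J (R (x - γ • (a + C x))) = x := by
      refine hA.resolvent_unique hγ0 (hJ _) ?_
      rwa [hRw, add_sub_cancel_left, inv_smul_smul₀ hγ0.ne']
    refine ⟨x - γ • (a + C x), ?_⟩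
    simp only [T]
    rw [hJw, hPw]
    abel
  have hu : ∀ k, z (k + 1) = T (z k) := fun k => by
    rw [hz, hA.resolvent_unique hγ0 (hzt k) (hJ _)]
  obtain ⟨l, hl, hlim⟩ := exists_weak_limit_of_averaged hc hT hfix hu
  -- At a fixed point the resolvent step and the projection coincide, so the resolvent inclusion at
  -- `R l` becomes an inclusion at P l whose defect is -γ⁻¹(l - P l) ∈ Vᗮ.
  have hJl : J (R l) = P l := by
    have h0 : l + J (R l) - P l = l := hl
    have h1 : J (R l) - P l = (l + J (R l) - P l) - l := by abel
    rw [h0, sub_self] at h1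
    exact sub_eq_zero.1 h1
  refine ⟨P l, Submodule.starProjection_apply_mem _ _, ⟨_, hJl ▸ hJ (R l), ?_⟩, ?_⟩
  · have e : γ⁻¹ • (R l - P l) + C (P l) = -(γ⁻¹ • (l - P l)) := by
      have : R l - P l = -(l - P l) - γ • C (P l) := by
        simp only [R, two_smul]
        abel
      rw [this, smul_sub, inv_smul_smul₀ hγ0.ne', smul_neg]
      abel
    have h2 := Vᗮ.neg_mem (Vᗮ.smul_mem γ⁻¹ (Submodule.sub_starProjection_mem_orthogonal (K := V) l))
    rw [← hP, ← e] at h2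
    exact h2
  -- Self-adjointness moves P onto the test vector.
  · refine weakTendsto_of_forall_inner fun y => ?_
    have h := hlim (P y)
    simp only [hP, ← Submodule.inner_starProjection_left_eq_right] at h
    exact h

end DavisYin

/-! ### Subgradients, proximal points, Baillon–Haddad and projections -/

section ConvexAnalysis

variable {E : Type*} [NormedAddCommGroup E] [InnerProductSpace ℝ E]

/-- The closed sublevel sets at integer heights cover the space, so by Baire one has interior. There
f is bounded above, and a convex function bounded above near one point is continuous. -/
theorem continuous_of_convexOn_of_lowerSemicontinuous [CompleteSpace E] {f : E → ℝ}
    (hf : ConvexOn ℝ Set.univ f) (hlsc : LowerSemicontinuous f) : Continuous f := by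
  have hcl : ∀ n : ℕ, IsClosed (f ⁻¹' Set.Iic (n : ℝ)) := fun n =>
    lowerSemicontinuous_iff_isClosed_preimage.1 hlsc n
  have hU : ⋃ n : ℕ, f ⁻¹' Set.Iic (n : ℝ) = Set.univ := by
    refine Set.eq_univ_of_forall fun x => ?_
    obtain ⟨n, hn⟩ := exists_nat_ge (f x)
    exact Set.mem_iUnion.2 ⟨n, hn⟩
  obtain ⟨n, x₀, hx₀⟩ := nonempty_interior_of_iUnion_of_closed hcl hU
  have hb : (𝓝 x₀).IsBoundedUnder (· ≤ ·) f :=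
    ⟨n, eventually_map.2 (mem_interior_iff_mem_nhds.1 hx₀)⟩
  have htfae := hf.continuousOn_tfae isOpen_univ Set.univ_nonempty
  have h := htfae.out 3 1
  exact continuousOn_univ.1 (h.1 ⟨x₀, Set.mem_univ _, hb⟩)

/-- Hahn–Banach separates (x, f x) from the open strict epigraph; normalizing the separating
functional by its vertical component gives a subgradient. -/
theorem subdiff_nonempty {f : E → ℝ} (hf : ConvexOn ℝ Set.univ f) (hc : Continuous f)
    [CompleteSpace E] (x : E) : (subdiff f x).Nonempty := by
  have hconv : Convex ℝ {p : E × ℝ | f p.1 < p.2} := by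
    simpa using hf.convex_strict_epigraph
  have hopen : IsOpen {p : E × ℝ | f p.1 < p.2} :=
    isOpen_lt (hc.comp continuous_fst) continuous_snd
  obtain ⟨g, hg⟩ := geometric_hahn_banach_open_point hconv hopen (x := (x, f x)) (by simp)
  let φ : StrongDual ℝ E := g.comp (ContinuousLinearMap.inl ℝ E ℝ)
  let c : ℝ := g (0, 1)
  have hsplit : ∀ y t, g (y, t) = φ y + t * c := by
    intro y t
    have e : ((y, t) : E × ℝ) = (y, 0) + t • (0, 1) := by simp
    rw [e, map_add, map_smul]
    rfl
  have hineq : ∀ y t, f y < t → φ y + t * c < φ x + f x * c := by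
    intro y t h
    rw [← hsplit, ← hsplit]
    exact hg (y, t) h
  -- Testing a point directly above x shows that the hyperplane is not vertical.
  have hc0 : c < 0 := by
    have := hineq x (f x + 1) (by linarith)
    linarith
  have hle : ∀ y, φ y + f y * c ≤ φ x + f x * c := by
    intro y
    have hlim : Tendsto (fun t : ℝ => φ y + t * c) (𝓝[>] (f y)) (𝓝 (φ y + f y * c)) :=
      (by fun_prop : Continuous fun t : ℝ => φ y + t * c).continuousWithinAt
    exact le_of_tendsto hlim (eventually_nhdsWithin_of_forall fun t ht => (hineq y t ht).le)
  refine ⟨(InnerProductSpace.toDual ℝ E).symm ((-c)⁻¹ • φ), fun y => ?_⟩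
  have h1 : inner ℝ ((InnerProductSpace.toDual ℝ E).symm ((-c)⁻¹ • φ)) (y - x)
      = (φ y - φ x) / (-c) := by
    rw [InnerProductSpace.toDual_symm_apply]
    simp only [smul_apply, map_sub, smul_eq_mul]
    ring
  have h2 : (φ y - φ x) / (-c) ≤ f y - f x := by
    rw [div_le_iff₀ (by linarith)]
    have := hle y
    linarith
  linarith

/-- A convex continuous nonnegative function has a proximal point. -/
theorem exists_forall_half_sq_add_le [CompleteSpace E] {φ : E → ℝ}
    (hφ : ConvexOn ℝ Set.univ φ) (hc : Continuous φ) (h0 : ∀ x, 0 ≤ φ x) (a : E) :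
    ∃ x, ∀ y, 1 / 2 * ‖x - a‖ ^ 2 + φ x ≤ 1 / 2 * ‖y - a‖ ^ 2 + φ y := by
  set G : E → ℝ := fun x => 1 / 2 * ‖x - a‖ ^ 2 + φ x with hG
  have hGc : Continuous G := by fun_prop
  have hGb : BddBelow (Set.range G) := by
    refine ⟨0, ?_⟩
    rintro _ ⟨x, rfl⟩
    have := h0 x
    positivity
  set m := ⨅ x, G x with hm
  have hmle : ∀ x, m ≤ G x := ciInf_le hGb
  -- The quadratic term makes G strongly convex: comparing the midpoint value with the infimum
  -- forces minimizing sequences to be Cauchy, hence strongly convergent.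
  have hpar : ∀ x y, ‖x - y‖ ^ 2 ≤ 4 * (G x + G y - 2 * m) := by
    intro x y
    have h1 := hmle ((1 / 2 : ℝ) • x + (1 / 2 : ℝ) • y)
    have h2 : φ ((1 / 2 : ℝ) • x + (1 / 2 : ℝ) • y) ≤ (1 / 2 : ℝ) • φ x + (1 / 2 : ℝ) • φ y :=
      hφ.2 (Set.mem_univ x) (Set.mem_univ y) (by norm_num) (by norm_num) (by norm_num)
    have h3 := parallelogram_law_with_norm ℝ (x - a) (y - a)
    have e1 : (x - a) + (y - a)
        = (2 : ℝ) • ((1 / 2 : ℝ) • x + (1 / 2 : ℝ) • y - a) := by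
      simp only [smul_add, smul_sub, smul_smul]
      norm_num
      rw [two_smul]
      abel
    have e2 : (x - a) - (y - a) = x - y := by abel
    rw [e1, e2, norm_smul] at h3
    norm_num at h3
    simp only [smul_eq_mul] at h2
    simp only [hG] at h1 ⊢
    nlinarith
  have hex : ∀ n : ℕ, ∃ x, G x < m + 1 / ((n : ℝ) + 1) := fun n =>
    exists_lt_of_ciInf_lt (lt_add_of_pos_right m Nat.one_div_pos_of_nat)
  choose u hu using hex
  have hcau : CauchySeq u := by
    refine cauchySeq_of_le_tendsto_0 (fun M : ℕ => √(8 * (1 / ((M : ℝ) + 1)))) ?_ ?_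
    · intro n k M hn hk
      rw [dist_eq_norm]
      refine Real.le_sqrt_of_sq_le ?_
      have h1 := hpar (u n) (u k)
      have h2 := hu n
      have h3 := hu k
      have h4 : 1 / ((n : ℝ) + 1) ≤ 1 / ((M : ℝ) + 1) := Nat.one_div_le_one_div hn
      have h5 : 1 / ((k : ℝ) + 1) ≤ 1 / ((M : ℝ) + 1) := Nat.one_div_le_one_div hk
      linarith
    · have := (tendsto_one_div_add_atTop_nhds_zero_nat (𝕜 := ℝ)).const_mul 8
      simpa using this.sqrt
  obtain ⟨x, hx⟩ := cauchySeq_tendsto_of_complete hcau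
  refine ⟨x, fun y => le_trans ?_ (hmle y)⟩
  have h1 : Tendsto (fun n => G (u n)) atTop (𝓝 (G x)) := (hGc.tendsto x).comp hx
  have h2 : Tendsto (fun n : ℕ => m + 1 / ((n : ℝ) + 1)) atTop (𝓝 m) := by
    simpa using (tendsto_one_div_add_atTop_nhds_zero_nat (𝕜 := ℝ)).const_add m
  exact le_of_tendsto_of_tendsto' h1 h2 fun n => (hu n).le

/-- Quadratic upper bound for the squared positive part, which stands in for differentiating it. -/
theorem max_zero_add_sq_le (s ε : ℝ) :
    max 0 (s + ε) ^ 2 ≤ max 0 s ^ 2 + 2 * max 0 s * ε + ε ^ 2 := by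
  rcases le_total 0 s with h | h <;> rcases le_total 0 (s + ε) with h' | h' <;>
    simp only [max_eq_left, max_eq_right, h, h'] <;> nlinarith

theorem nonneg_of_forall_add_mul_nonneg {K M : ℝ}
    (h : ∀ t : ℝ, 0 < t → t ≤ 1 → 0 ≤ K + t * M) : 0 ≤ K := by
  have hlim : Tendsto (fun t : ℝ => K + t * M) (𝓝[>] 0) (𝓝 (K + 0 * M)) :=
    (by fun_prop : Continuous fun t : ℝ => K + t * M).continuousWithinAt
  rw [zero_mul, add_zero] at hlim
  exact ge_of_tendsto hlim (by
    filter_upwards [Ioc_mem_nhdsGT (zero_lt_one' ℝ)] with t ht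
    exact h t ht.1 ht.2)

/-- The resolvent of the saddle operator `(x, p) ↦ p ∂f(x) × (N_{ℝ₊}(p) - f(x))` is everywhere
defined. -/
theorem exists_saddle_resolvent [CompleteSpace E] {f : E → ℝ} (hf : ConvexOn ℝ Set.univ f)
    (hc : Continuous f) {γ : ℝ} (hγ : 0 < γ) (a : E) (b : ℝ) :
    ∃ (x : E) (p : ℝ), ∃ u ∈ subdiff f x, ∃ v ∈ normalCone (Set.Ici (0 : ℝ)) p,
      γ⁻¹ • (a - x) = p • u ∧ γ⁻¹ * (b - p) = v - f x := by
  -- Objective left after eliminating p = max(0, b + γ f(x)). Its x-derivative is formally γ p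
  -- ∂f(x), as the first component of the inclusion requires.
  have hconv : ConvexOn ℝ Set.univ fun x => 1 / 2 * max 0 (b + γ * f x) ^ 2 := by
    have h1 : ConvexOn ℝ Set.univ fun x => b + γ * f x :=
      (convexOn_const b convex_univ).add (hf.smul hγ.le)
    have h2 : ConvexOn ℝ Set.univ fun x => max 0 (b + γ * f x) :=
      (convexOn_const 0 convex_univ).sup h1
    exact (h2.pow (fun _ _ => le_max_left _ _) 2).smul (by norm_num : (0 : ℝ) ≤ 1 / 2)
  obtain ⟨x, hx⟩ := exists_forall_half_sq_add_le hconv (by fun_prop) (fun x => by positivity) a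
  set p := max 0 (b + γ * f x) with hp
  have hp0 : 0 ≤ p := le_max_left _ _
  -- First-order optimality of x: compare with x + t(y - x), divide by t and let t → 0.
  have hfirst : ∀ y, inner ℝ (a - x) (y - x) ≤ γ * p * (f y - f x) := by
    intro y
    suffices 0 ≤ inner ℝ (x - a) (y - x) + p * (γ * (f y - f x)) by
      have e : inner ℝ (x - a) (y - x) = -inner ℝ (a - x) (y - x) := by
        rw [← inner_neg_left, neg_sub]
      linarith
    refine nonneg_of_forall_add_mul_nonneg
      (M := 1 / 2 * (‖y - x‖ ^ 2 + (γ * (f y - f x)) ^ 2)) fun t ht ht1 => ?_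
    have h1 := hx (x + t • (y - x))
    have h2 : f (x + t • (y - x)) ≤ f x + t * (f y - f x) := by
      have h3 := hf.2 (Set.mem_univ x) (Set.mem_univ y) (by linarith : 0 ≤ 1 - t) ht.le (by ring)
      have e : (1 - t) • x + t • y = x + t • (y - x) := by
        rw [sub_smul, one_smul, smul_sub]
        abel
      rw [e, smul_eq_mul, smul_eq_mul] at h3
      linarith
    have h4 : max 0 (b + γ * f (x + t • (y - x))) ^ 2
        ≤ max 0 ((b + γ * f x) + t * (γ * (f y - f x))) ^ 2 := by
      have := mul_le_mul_of_nonneg_left h2 hγ.le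
      exact pow_le_pow_left₀ (le_max_left _ _) (max_le_max le_rfl (by linarith)) 2
    have h5 := max_zero_add_sq_le (b + γ * f x) (t * (γ * (f y - f x)))
    have e : x + t • (y - x) - a = (x - a) + t • (y - x) := by abel
    rw [e, norm_add_sq_real, inner_smul_right, norm_smul, mul_pow, Real.norm_eq_abs, sq_abs] at h1
    rw [← hp] at h5
    have h6 : 0 ≤ t * (inner ℝ (x - a) (y - x) + p * (γ * (f y - f x))
        + t * (1 / 2 * (‖y - x‖ ^ 2 + (γ * (f y - f x)) ^ 2))) := by
      nlinarith
    exact nonneg_of_mul_nonneg_right h6 ht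
  have hsnd : γ⁻¹ * (b - p) = (γ⁻¹ * (b - p) + f x) - f x := by ring
  -- If p = 0, optimality tested at y = a gives x = a, and any subgradient serves because it is
  -- multiplied by 0. If p > 0, dividing by γ p produces the subgradient, and the normal vector is
  -- 0.
  rcases hp0.eq_or_lt with h0 | hpos
  · obtain ⟨u, hu⟩ := subdiff_nonempty hf hc x
    refine ⟨x, p, u, hu, _, ⟨hp0, fun y hy => ?_⟩, ?_, hsnd⟩
    · have h1 : b + γ * f x ≤ 0 := by
        have := le_max_right 0 (b + γ * f x)
        rwa [← hp, ← h0] at this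
      have h2 : γ⁻¹ * (b - p) + f x = γ⁻¹ * (b + γ * f x) := by
        rw [← h0]
        field_simp
        ring
      have h3 : γ⁻¹ * (b + γ * f x) ≤ 0 :=
        mul_nonpos_of_nonneg_of_nonpos (inv_nonneg.2 hγ.le) h1
      rw [h2, ← h0, sub_zero]
      simp only [Real.inner_apply]
      exact mul_nonpos_of_nonpos_of_nonneg h3 hy
    · have h1 := hfirst a
      rw [← h0, mul_zero, zero_mul, real_inner_self_eq_norm_sq] at h1
      have h2 : a - x = 0 := norm_eq_zero.1
        (pow_eq_zero_iff two_ne_zero |>.1 (le_antisymm h1 (sq_nonneg _)))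
      rw [h2, ← h0, smul_zero, zero_smul]
  · have hpe : p = b + γ * f x := by
      rcases le_total 0 (b + γ * f x) with h | h
      · rw [hp, max_eq_right h]
      · rw [hp, max_eq_left h] at hpos
        exact absurd hpos (lt_irrefl _)
    refine ⟨x, p, (γ * p)⁻¹ • (a - x), fun y => ?_, _, ⟨hp0, fun y hy => ?_⟩, ?_, hsnd⟩
    · have h1 : inner ℝ ((γ * p)⁻¹ • (a - x)) (y - x) ≤ f y - f x := by
        rw [inner_smul_left, conj_trivial, inv_mul_le_iff₀ (by positivity)]
        exact hfirst y
      linarith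
    · have : γ⁻¹ * (b - p) + f x = 0 := by
        rw [hpe]
        field_simp
        ring
      rw [this, inner_zero_left]
    · rw [smul_smul]
      congr 1
      field_simp

theorem hasDerivAt_comp_line [CompleteSpace E] {h : E → ℝ} (hd : Differentiable ℝ h) (x v : E)
    (t : ℝ) :
    HasDerivAt (fun s : ℝ => h (x + s • v)) (inner ℝ (gradient h (x + t • v)) v) t := by
  have h1 : HasDerivAt (fun s : ℝ => x + s • v) v t := by
    simpa using ((hasDerivAt_id t).smul_const v).const_add x
  have h2 := (hd (x + t • v)).hasGradientAt.hasFDerivAt.comp_hasDerivAt t h1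
  rw [InnerProductSpace.toDual_apply_apply] at h2
  exact h2

theorem gradient_mem_subdiff [CompleteSpace E] {h : E → ℝ} (hcv : ConvexOn ℝ Set.univ h)
    (hd : Differentiable ℝ h) (x : E) : gradient h x ∈ subdiff h x := by
  intro y
  have h1 : ConvexOn ℝ Set.univ fun s : ℝ => h (x + s • (y - x)) := by
    have e : (fun s : ℝ => h (x + s • (y - x))) = h ∘ (AffineMap.lineMap x y : ℝ →ᵃ[ℝ] E) := by
      ext s
      simp [AffineMap.lineMap_apply, add_comm]
    rw [e]
    simpa using hcv.comp_affineMap (AffineMap.lineMap x y : ℝ →ᵃ[ℝ] E)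
  have h2 := h1.le_slope_of_hasDerivAt (Set.mem_univ 0) (Set.mem_univ 1) zero_lt_one
    (hasDerivAt_comp_line hd x (y - x) 0)
  simp only [slope_def_field, zero_smul, one_smul, add_zero, add_sub_cancel, sub_zero,
    div_one] at h2
  linarith

/-- The descent lemma. -/
theorem le_add_inner_gradient_add_sq [CompleteSpace E] {h : E → ℝ} (hd : Differentiable ℝ h)
    {L : ℝ} (hL : ∀ x y, ‖gradient h x - gradient h y‖ ≤ L * ‖x - y‖) (x v : E) :
    h (x + v) ≤ h x + inner ℝ (gradient h x) v + L / 2 * ‖v‖ ^ 2 := by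
  -- The gap in the desired bound along the segment, up to a constant; the Lipschitz condition makes
  -- it nonincreasing on [0, 1].
  let ψ : ℝ → ℝ := fun t =>
    h (x + t • v) - t * inner ℝ (gradient h x) v - L / 2 * t ^ 2 * ‖v‖ ^ 2
  have hψ : ∀ t, HasDerivAt ψ
      (inner ℝ (gradient h (x + t • v)) v - inner ℝ (gradient h x) v - L * t * ‖v‖ ^ 2) t := by
    intro t
    have h1 := ((hasDerivAt_comp_line hd x v t).sub
      ((hasDerivAt_id t).mul_const (inner ℝ (gradient h x) v))).sub
      ((((hasDerivAt_id t).pow 2).const_mul (L / 2)).mul_const (‖v‖ ^ 2))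
    refine h1.congr_deriv ?_
    push_cast
    simp only [id]
    ring
  have hanti : AntitoneOn ψ (Set.Icc 0 1) := by
    refine antitoneOn_of_deriv_nonpos (convex_Icc 0 1)
      (fun t _ => (hψ t).continuousAt.continuousWithinAt)
      (fun t _ => (hψ t).differentiableAt.differentiableWithinAt) fun t ht => ?_
    rw [interior_Icc] at ht
    rw [(hψ t).deriv, ← inner_sub_left]
    have h1 := real_inner_le_norm (gradient h (x + t • v) - gradient h x) v
    have h2 := hL (x + t • v) x
    rw [add_sub_cancel_left, norm_smul, Real.norm_of_nonneg ht.1.le] at h2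
    have h3 := mul_le_mul_of_nonneg_right h2 (norm_nonneg v)
    nlinarith
  have h01 := hanti (Set.left_mem_Icc.2 zero_le_one) (Set.right_mem_Icc.2 zero_le_one) zero_le_one
  simp only [ψ, one_smul, zero_smul, add_zero] at h01
  linarith

/-- The Baillon–Haddad theorem. -/
theorem gradient_cocoercive [CompleteSpace E] {h : E → ℝ} (hcv : ConvexOn ℝ Set.univ h)
    (hd : Differentiable ℝ h) {β : ℝ} (hβ : 0 < β)
    (hlip : ∀ x y, ‖gradient h x - gradient h y‖ ≤ β⁻¹ * ‖x - y‖) (x y : E) :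
    β * ‖gradient h x - gradient h y‖ ^ 2
      ≤ inner ℝ (gradient h x - gradient h y) (x - y) := by
  have key : ∀ x y, h x + inner ℝ (gradient h x) (y - x)
      + β / 2 * ‖gradient h y - gradient h x‖ ^ 2 ≤ h y := by
    intro x y
    set g := gradient h y - gradient h x with hg
    -- The test point y - βg is a gradient step, of length 1/L for L = β⁻¹, on h minus its
    -- linearization at x. Convexity bounds h there from below, the descent lemma from above.
    have h1 := gradient_mem_subdiff hcv hd x (y + -(β • g))
    have h2 := le_add_inner_gradient_add_sq hd hlip y (-(β • g))
    have e1 : y + -(β • g) - x = (y - x) + -(β • g) := by abel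
    have e2 : inner ℝ (gradient h y) g - inner ℝ (gradient h x) g = ‖g‖ ^ 2 := by
      rw [← inner_sub_left, ← hg, real_inner_self_eq_norm_sq]
    rw [e1, inner_add_right, inner_neg_right, inner_smul_right] at h1
    rw [inner_neg_right, inner_smul_right, norm_neg, norm_smul, Real.norm_of_nonneg hβ.le] at h2
    have e3 : β⁻¹ / 2 * (β * ‖g‖) ^ 2 = β / 2 * ‖g‖ ^ 2 := by
      field_simp
    rw [e3] at h2
    have e4 : β * inner ℝ (gradient h y) g - β * inner ℝ (gradient h x) g = β * ‖g‖ ^ 2 := by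
      rw [← e2]
      ring
    linarith
  have h1 := key x y
  have h2 := key y x
  rw [norm_sub_rev] at h1
  have e : inner ℝ (gradient h x) (y - x) = -inner ℝ (gradient h x) (x - y) := by
    rw [← inner_neg_right, neg_sub]
  rw [inner_sub_left]
  linarith

theorem sub_proj_mem_normalCone [CompleteSpace E] {C : Set E} (hne : C.Nonempty)
    (hcl : IsClosed C) (hcv : Convex ℝ C) (x : E) : x - proj C x ∈ normalCone C (proj C x) := by
  have hex : ∃ y, y ∈ C ∧ ∀ w ∈ C, ‖x - y‖ ≤ ‖x - w‖ := by
    obtain ⟨v, hv, h⟩ := exists_norm_eq_iInf_of_complete_convex hne hcl.isComplete hcv x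
    refine ⟨v, hv, fun w hw => ?_⟩
    rw [h]
    exact ciInf_le (f := fun w : C => ‖x - w‖)
      ⟨0, by rintro _ ⟨w, rfl⟩; exact norm_nonneg _⟩ ⟨w, hw⟩
  obtain ⟨hmem, hmin⟩ : proj C x ∈ C ∧ ∀ w ∈ C, ‖x - proj C x‖ ≤ ‖x - w‖ :=
    Classical.epsilon_spec hex
  refine ⟨hmem, (norm_eq_iInf_iff_real_inner_le_zero hcv hmem).1 ?_⟩
  have : Nonempty C := ⟨⟨_, hmem⟩⟩
  exact le_antisymm (le_ciInf fun w => hmin w w.2)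
    (ciInf_le (f := fun w : C => ‖x - w‖)
      ⟨0, by rintro _ ⟨w, rfl⟩; exact norm_nonneg _⟩ ⟨_, hmem⟩)

theorem smul_mem_normalCone {C : Set E} {x u : E} {c : ℝ} (hc : 0 ≤ c)
    (hu : u ∈ normalCone C x) : c • u ∈ normalCone C x := by
  refine ⟨hu.1, fun y hy => ?_⟩
  rw [inner_smul_left, conj_trivial]
  exact mul_nonpos_of_nonneg_of_nonpos hc (hu.2 y hy)

theorem isMonotone_normalCone (C : Set E) : IsMonotone (normalCone C) := by
  intro x y u hu v hv
  have h1 := hu.2 y hv.1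
  have h2 := hv.2 x hu.1
  have e : inner ℝ u (y - x) = -inner ℝ u (x - y) := by rw [← inner_neg_right, neg_sub]
  rw [inner_sub_left]
  linarith

/-- On a subspace, the normal cone is the orthogonal complement. -/
theorem mem_normalCone_submodule {V : Submodule ℝ E} {x u : E} :
    u ∈ normalCone (V : Set E) x ↔ x ∈ V ∧ u ∈ Vᗮ := by
  refine ⟨fun hu => ⟨hu.1, (Submodule.mem_orthogonal' _ _).2 fun v hv => ?_⟩, fun hu =>
    ⟨hu.1, fun y hy => ?_⟩⟩
  · have h1 := hu.2 (x + v) (V.add_mem hu.1 hv)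
    have h2 := hu.2 (x - v) (V.sub_mem hu.1 hv)
    rw [add_sub_cancel_left] at h1
    rw [sub_sub_cancel_left, inner_neg_right] at h2
    linarith
  · exact ((Submodule.mem_orthogonal' _ _).1 hu.2 _ (V.sub_mem hy hu.1)).le

/-- `res` is an epsilon choice, so mere existence of a solution gives its defining inclusion. -/
theorem res_spec {A : E → Set E} {γ : ℝ} (hγ : 0 < γ) {x : E}
    (h : ∃ y, γ⁻¹ • (x - y) ∈ A y) :
    γ⁻¹ • (x - res (γ • A) x) ∈ A (res (γ • A) x) := by
  have key : ∀ y, x ∈ {y} + (γ • A) y ↔ γ⁻¹ • (x - y) ∈ A y := by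
    intro y
    rw [Pi.smul_apply, Set.singleton_add, Set.mem_image]
    constructor
    · rintro ⟨w, hw, rfl⟩
      rw [add_sub_cancel_left]
      exact (Set.mem_smul_set_iff_inv_smul_mem₀ hγ.ne' _ _).1 hw
    · intro hw
      exact ⟨x - y, (Set.mem_smul_set_iff_inv_smul_mem₀ hγ.ne' _ _).2 hw, by abel⟩
  have hex : ∃ y, x ∈ {y} + (γ • A) y := h.imp fun y => (key y).2
  exact (key _).1 (Classical.epsilon_spec hex)

end ConvexAnalysis

/-! ### Averaging as projection onto the diagonal; blockwise splitting -/

section Diagonal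

variable {F : Type*} [NormedAddCommGroup F] [InnerProductSpace ℝ F]

/-- The diagonal of a finite power of a Hilbert space, as a subspace. -/
def diagSubmodule (F : Type*) [NormedAddCommGroup F] [InnerProductSpace ℝ F] (n : ℕ) :
    Submodule ℝ (PiLp 2 fun _ : Fin n => F) where
  carrier := {z | ∀ i j, z i = z j}
  add_mem' {x y} hx hy i j := by rw [PiLp.add_apply, PiLp.add_apply, hx i j, hy i j]
  zero_mem' _ _ := rfl
  smul_mem' c x hx i j := by rw [PiLp.smul_apply, PiLp.smul_apply, hx i j]

theorem average_mem_diagSubmodule {m : ℕ} (c : F) :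
    (WithLp.toLp 2 fun _ => c : PiLp 2 fun _ : Fin (m + 1) => F) ∈ diagSubmodule F (m + 1) :=
  fun _ _ => rfl

/-- Against a constant family the inner product only sees the sum of the deviations from the mean,
which is zero. -/
theorem sub_average_mem_orthogonal {m : ℕ} (z : PiLp 2 fun _ : Fin (m + 1) => F) :
    z - WithLp.toLp 2 (fun _ => (1 / ((m : ℝ) + 1)) • ∑ j, z j) ∈ (diagSubmodule F (m + 1))ᗮ := by
  refine (Submodule.mem_orthogonal' _ _).2 fun v hv => ?_
  have hv0 : ∀ i, v i = v 0 := fun i => hv i 0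
  have hm : (m : ℝ) + 1 ≠ 0 := by positivity
  rw [PiLp.inner_apply]
  simp only [hv0, PiLp.sub_apply]
  rw [← sum_inner, Finset.sum_sub_distrib, Finset.sum_const, Finset.card_univ, Fintype.card_fin,
    ← Nat.cast_smul_eq_nsmul ℝ, smul_smul]
  have : ((m + 1 : ℕ) : ℝ) * (1 / ((m : ℝ) + 1)) = 1 := by
    push_cast
    field_simp
  rw [this, one_smul, sub_self, inner_zero_left]

instance {m : ℕ} : (diagSubmodule F (m + 1)).HasOrthogonalProjection where
  exists_orthogonal z := ⟨_, average_mem_diagSubmodule _, sub_average_mem_orthogonal z⟩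

theorem starProjection_diagSubmodule {m : ℕ} (z : PiLp 2 fun _ : Fin (m + 1) => F) :
    (diagSubmodule F (m + 1)).starProjection z
      = WithLp.toLp 2 (fun _ => (1 / ((m : ℝ) + 1)) • ∑ j, z j) :=
  Submodule.eq_starProjection_of_mem_orthogonal (average_mem_diagSubmodule _)
    (sub_average_mem_orthogonal z)

theorem zero_mem_add_normalCone_iff {V : Submodule ℝ F} {S : Set F} {c x : F} :
    (0 : F) ∈ S + {c} + normalCone (V : Set F) x ↔ x ∈ V ∧ ∃ a ∈ S, a + c ∈ Vᗮ := by
  rw [Set.mem_add]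
  constructor
  · rintro ⟨s, hs, n, hn, h0⟩
    obtain ⟨a, ha, _, rfl, rfl⟩ := Set.mem_add.1 hs
    obtain ⟨hx, hn⟩ := mem_normalCone_submodule.1 hn
    refine ⟨hx, a, ha, ?_⟩
    rw [eq_neg_of_add_eq_zero_left h0]
    exact Vᗮ.neg_mem hn
  · rintro ⟨hx, a, ha, h⟩
    exact ⟨a + c, Set.add_mem_add ha rfl, -(a + c),
      mem_normalCone_submodule.2 ⟨hx, Vᗮ.neg_mem h⟩, add_neg_cancel _⟩

/-- Davis–Yin splitting in a finite power of a Hilbert space, with a cocoercive operator acting on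
the first block only. -/
theorem exists_weak_limit_block_davisYin [CompleteSpace F] {m : ℕ} {A : Fin (m + 1) → F → Set F}
    (hA : ∀ i, IsMonotone (A i)) {c : F → F} {β γ : ℝ} (hβ : 0 < β)
    (hγ : γ ∈ Set.Ioo 0 (2 * β))
    (hc : ∀ x y, β * ‖c x - c y‖ ^ 2 ≤ inner ℝ (c x - c y) (x - y))
    (hres : ∀ i x, ∃ y, γ⁻¹ • (x - y) ∈ A i y)
    (hsol : ∃ x : PiLp 2 fun _ : Fin (m + 1) => F,
      0 ∈ {w : PiLp 2 fun _ : Fin (m + 1) => F | ∀ i, w i ∈ A i (x i)}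
        + {WithLp.toLp 2 fun i => if i = 0 then c (x 0) else 0}
        + normalCone (diagSubmodule F (m + 1) : Set _) x)
    {z zb zt : ℕ → PiLp 2 fun _ : Fin (m + 1) => F}
    (havg : ∀ k i, zb k i = (1 / ((m : ℝ) + 1)) • ∑ j, z k j)
    (hzt : ∀ k i, γ⁻¹ • ((2 : ℝ) • zb k i - z k i - γ • (if i = 0 then c (zb k 0) else 0)
      - zt k i) ∈ A i (zt k i))
    (hz : ∀ k i, z (k + 1) i = z k i + zt k i - zb k i) :
    ∃ x : PiLp 2 fun _ : Fin (m + 1) => F,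
      0 ∈ {w : PiLp 2 fun _ : Fin (m + 1) => F | ∀ i, w i ∈ A i (x i)}
        + {WithLp.toLp 2 fun i => if i = 0 then c (x 0) else 0}
        + normalCone (diagSubmodule F (m + 1) : Set _) x ∧ WeakTendsto zb x := by
  have hzb : ∀ k, (diagSubmodule F (m + 1)).starProjection (z k) = zb k := by
    intro k
    rw [starProjection_diagSubmodule]
    ext i
    exact (havg k i).symm
  simp only [zero_mem_add_normalCone_iff] at hsol ⊢
  have hmono : IsMonotone fun x : PiLp 2 fun _ : Fin (m + 1) => F =>
      {w : PiLp 2 fun _ : Fin (m + 1) => F | ∀ i, w i ∈ A i (x i)} := by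
    intro x y u hu v hv
    rw [PiLp.inner_apply]
    exact Finset.sum_nonneg fun i _ => hA i _ _ _ (hu i) _ (hv i)
  have hcoc : ∀ x y : PiLp 2 fun _ : Fin (m + 1) => F,
      β * ‖(WithLp.toLp 2 fun i => if i = 0 then c (x 0) else 0 : PiLp 2 fun _ : Fin (m + 1) => F)
        - WithLp.toLp 2 fun i => if i = 0 then c (y 0) else 0‖ ^ 2
      ≤ inner ℝ ((WithLp.toLp 2 fun i => if i = 0 then c (x 0) else 0 :
          PiLp 2 fun _ : Fin (m + 1) => F)
        - WithLp.toLp 2 fun i => if i = 0 then c (y 0) else 0) (x - y) := by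
    intro x y
    rw [PiLp.norm_sq_eq_of_L2, PiLp.inner_apply, Finset.sum_eq_single 0, Finset.sum_eq_single 0]
    · simpa using hc (x 0) (y 0)
    · intro i _ hi
      simp [hi]
    · simp
    · intro i _ hi
      simp [hi]
    · simp
  obtain ⟨x, hx, ⟨a, ha, hax⟩, hlim⟩ := exists_weak_limit_davisYin hmono hβ hγ hcoc
    (diagSubmodule F (m + 1))
    (fun x => by
      choose y hy using fun i => hres i (x i)
      exact ⟨WithLp.toLp 2 y, hy⟩)
    (by
      obtain ⟨x, hx, a, ha, h⟩ := hsol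
      exact ⟨x, hx, a, ha, h⟩)
    (z := z) (zt := zt)
    (fun k i => by
      rw [hzb]
      exact hzt k i)
    (fun k => by
      rw [hzb]
      ext i
      exact hz k i)
  simp only [hzb] at hlim
  exact ⟨x, ⟨hx, a, ha, hax⟩, hlim⟩

end Diagonal

/-! ### Monotonicity and resolvents of the block operators -/

section Blocks

variable {H : Type*} [NormedAddCommGroup H] [InnerProductSpace ℝ H] {N : ℕ}

/-- Multiply the two subgradient inequalities by p_i and p'_i, which are nonnegative because the
normal cone is empty elsewhere. Their sum produces (p_i - p'_i)(f_i(x) - f_i(x')), exactly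
cancelling the contribution of -f_i in the second component. -/
theorem isMonotone_B (f : Fin N → H → ℝ) (i : Fin N) : IsMonotone (B f i) := by
  rintro x y _ ⟨u, hu, v, hv, rfl⟩ _ ⟨u', hu', v', hv', rfl⟩
  have h1 := mul_le_mul_of_nonneg_left (hu y.fst) hv.1
  have h2 := mul_le_mul_of_nonneg_left (hu' x.fst) hv'.1
  have h3 := isMonotone_normalCone (Set.Ici (0 : ℝ)) _ _ v hv v' hv'
  have e : inner ℝ u (y.fst - x.fst) = -inner ℝ u (x.fst - y.fst) := by
    rw [← inner_neg_right, neg_sub]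
  rw [WithLp.prod_inner_apply]
  simp only [WithLp.ofLp_sub, Prod.fst_sub, Prod.snd_sub, inner_sub_left,
    EuclideanSpace.inner_single_left, inner_smul_left, conj_trivial, PiLp.sub_apply] at h3 ⊢
  simp only [Real.inner_apply] at h3
  change x.snd i * _ ≤ _ at h1
  rw [e] at h1
  change 0 ≤ x.snd i * inner ℝ u (x.fst - y.fst) - y.snd i * inner ℝ u' (x.fst - y.fst)
    + ((v - f i x.fst) * (x.snd i - y.snd i) - (v' - f i y.fst) * (x.snd i - y.snd i))
  linarith

/-- Only x and the i-th weight interact, so the scalar saddle resolvent is used there and the other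
weights are left unchanged. -/
theorem exists_resolvent_B [CompleteSpace H] {f : Fin N → H → ℝ}
    (hfcv : ∀ i, ConvexOn ℝ Set.univ (f i)) (hflsc : ∀ i, LowerSemicontinuous (f i)) {γ : ℝ}
    (hγ : 0 < γ) (i : Fin N) (z : Block H N) : ∃ y, γ⁻¹ • (z - y) ∈ B f i y := by
  obtain ⟨x, p, u, hu, v, hv, h1, h2⟩ := exists_saddle_resolvent (hfcv i)
    (continuous_of_convexOn_of_lowerSemicontinuous (hfcv i) (hflsc i)) hγ z.fst (z.snd i)
  have hp : (z.snd - EuclideanSpace.single i (z.snd i - p)) i = p := by simp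
  refine ⟨pair x (z.snd - EuclideanSpace.single i (z.snd i - p)), u, hu, v, ?_, ?_⟩
  · change v ∈ normalCone _ ((z.snd - EuclideanSpace.single i (z.snd i - p)) i)
    rwa [hp]
  · change _ = pair ((z.snd - EuclideanSpace.single i (z.snd i - p)) i • u)
      (EuclideanSpace.single i (v - f i x))
    rw [hp, ← h1, ← h2]
    refine WithLp.ofLp_injective 2 (Prod.ext rfl ?_)
    change γ⁻¹ • (z.snd - (z.snd - EuclideanSpace.single i (z.snd i - p))) = _
    rw [sub_sub_cancel]
    ext j
    by_cases hj : j = i <;> simp [hj]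

theorem isMonotone_A₁ (Q : Set H) : IsMonotone (A₁ Q : Block H N → Set (Block H N)) := by
  intro x y u hu v hv
  rw [WithLp.prod_inner_apply]
  exact add_nonneg (isMonotone_normalCone _ _ _ _ hu.1 _ hv.1)
    (isMonotone_normalCone _ _ _ _ hu.2 _ hv.2)

theorem isMonotone_AP (P : Set (EuclideanSpace ℝ (Fin N))) :
    IsMonotone (AP P : Block H N → Set (Block H N)) := by
  intro x y u hu v hv
  rw [WithLp.prod_inner_apply]
  refine add_nonneg (le_of_eq ?_) (isMonotone_normalCone _ _ _ _ hu.2 _ hv.2)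
  change (0 : ℝ) = inner ℝ (u.fst - v.fst) _
  rw [hu.1, hv.1, sub_zero, inner_zero_left]

theorem smul_sub_proj_mem_A₁ [CompleteSpace H] {Q : Set H} (hQne : Q.Nonempty)
    (hQcl : IsClosed Q) (hQcv : Convex ℝ Q) (hP₁ : (P₁ N).Nonempty) {γ : ℝ} (hγ : 0 < γ)
    (z : Block H N) :
    γ⁻¹ • (z - pair (proj Q z.fst) (proj (P₁ N) z.snd))
      ∈ A₁ Q (pair (proj Q z.fst) (proj (P₁ N) z.snd)) := by
  have hlin : IsLinearMap ℝ fun p : EuclideanSpace ℝ (Fin N) => ∑ i, p i :=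
    ⟨fun x y => by simp [Finset.sum_add_distrib], fun c x => by simp [Finset.mul_sum]⟩
  have hcl : IsClosed (P₁ N) := isClosed_eq (by fun_prop) continuous_const
  have hcv : Convex ℝ (P₁ N) := convex_hyperplane hlin 1
  exact ⟨smul_mem_normalCone (inv_nonneg.2 hγ.le) (sub_proj_mem_normalCone hQne hQcl hQcv _),
    smul_mem_normalCone (inv_nonneg.2 hγ.le) (sub_proj_mem_normalCone hP₁ hcl hcv _)⟩

theorem smul_sub_proj_mem_AP {P : Set (EuclideanSpace ℝ (Fin N))} (hPne : P.Nonempty)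
    (hPcl : IsClosed P) (hPcv : Convex ℝ P) {γ : ℝ} (hγ : 0 < γ) (z : Block H N) :
    γ⁻¹ • (z - pair z.fst (proj P z.snd)) ∈ AP P (pair z.fst (proj P z.snd)) := by
  refine ⟨?_, smul_mem_normalCone (inv_nonneg.2 hγ.le)
    (sub_proj_mem_normalCone hPne hPcl hPcv _)⟩
  change γ⁻¹ • (z.fst - z.fst) = 0
  rw [sub_self, smul_zero]

theorem pair_gradient_cocoercive [CompleteSpace H] {h : H → ℝ} (hcv : ConvexOn ℝ Set.univ h)
    (hd : Differentiable ℝ h) {β : ℝ} (hβ : 0 < β)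
    (hlip : ∀ x y, ‖gradient h x - gradient h y‖ ≤ β⁻¹ * ‖x - y‖) (x y : Block H N) :
    β * ‖(pair (gradient h x.fst) 0 : Block H N) - pair (gradient h y.fst) 0‖ ^ 2
      ≤ inner ℝ ((pair (gradient h x.fst) 0 : Block H N) - pair (gradient h y.fst) 0)
        (x - y) := by
  rw [WithLp.prod_inner_apply, WithLp.prod_norm_sq_eq_of_L2]
  simpa using gradient_cocoercive hcv hd hβ hlip x.fst y.fst

theorem pair_reflection_sub_smul_pair (a b : Block H N) (γ : ℝ) (g : H) :
    pair ((2 : ℝ) • a.fst - b.fst - γ • g) ((2 : ℝ) • a.snd - b.snd)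
      = (2 : ℝ) • a - b - γ • (pair g 0 : Block H N) := by
  refine WithLp.ofLp_injective 2 (Prod.ext rfl ?_)
  change _ = (2 : ℝ) • a.snd - b.snd - γ • (0 : EuclideanSpace ℝ (Fin N))
  rw [smul_zero, sub_zero]

end Blocks

/-! ### Convergence of the routines -/

section Routines

variable {H : Type*} [NormedAddCommGroup H] [InnerProductSpace ℝ H] [CompleteSpace H] {N : ℕ}

theorem convergence₁ (hN : 1 ≤ N) {Q : Set H} (hQne : Q.Nonempty) (hQcl : IsClosed Q)
    (hQcv : Convex ℝ Q) {h : H → ℝ} (hcv : ConvexOn ℝ Set.univ h) (hdiff : Differentiable ℝ h)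
    {β : ℝ} (hβ : 0 < β) (hlip : ∀ x y, ‖gradient h x - gradient h y‖ ≤ β⁻¹ * ‖x - y‖)
    {f : Fin N → H → ℝ} (hfcv : ∀ i, ConvexOn ℝ Set.univ (f i))
    (hflsc : ∀ i, LowerSemicontinuous (f i)) {γ : ℝ} (hγ : γ ∈ Set.Ioo 0 (2 * β))
    (hsol : ∃ z, IsSol₁ h f Q z) {z zb zt : ℕ → ProdSpace H N (N + 1)}
    (hz : IsDavisYin₁ h f Q γ z zb zt) : ∃ zs, IsSol₁ h f Q zs ∧ WeakTendsto zb zs := by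
  have hγ0 := hγ.1
  let A : Fin (N + 1) → Block H N → Set (Block H N) := Fin.snoc (fun i => B f i) (A₁ Q)
  have hAc : ∀ i : Fin N, A i.castSucc = B f i := fun i => by
    simp only [A, Fin.snoc_castSucc]
  have hAl : A (Fin.last N) = A₁ Q := by simp only [A, Fin.snoc_last]
  have hprod : ∀ x : ProdSpace H N (N + 1), prodA₁ f Q x = {w | ∀ i, w i ∈ A i (x i)} := by
    intro x
    ext w
    change _ ∧ _ ↔ ∀ i, _
    rw [Fin.forall_fin_succ', hAl]
    simp only [hAc]
  have hiff : ∀ x : ProdSpace H N (N + 1), IsSol₁ h f Q x ↔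
      0 ∈ {w : ProdSpace H N (N + 1) | ∀ i, w i ∈ A i (x i)}
        + {WithLp.toLp 2 fun i => if i = 0 then pair (gradient h (x 0).fst) 0 else 0}
        + normalCone (diagSubmodule (Block H N) (N + 1) : Set _) x := by
    intro x
    rw [← hprod]
    rfl
  -- A solution has a nonempty normal cone to `P₁` in its last block, so `P₁` contains a point.
  have hP₁ : (P₁ N).Nonempty := by
    obtain ⟨x, hx⟩ := hsol
    obtain ⟨-, a, ha, -⟩ :=
      zero_mem_add_normalCone_iff (V := diagSubmodule (Block H N) (N + 1)).1 hx
    exact ⟨_, ha.2.2.1⟩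
  -- Since N ≥ 1, block 0 carries B_1 and not `A₁`, so the gradient term does not enter the
  -- projection step.
  have hlast : Fin.last N ≠ 0 := fun h0 => by
    have := congrArg Fin.val h0
    simp at this
    omega
  simp only [hiff] at hsol ⊢
  refine exists_weak_limit_block_davisYin (c := fun x => pair (gradient h x.fst) 0)
    (z := z) (zt := zt) (fun i => ?_) hβ hγ (pair_gradient_cocoercive hcv hdiff hβ hlip)
    (fun i x => ?_) hsol hz.average (fun k i => ?_) hz.update
  · refine Fin.lastCases ?_ (fun i => ?_) i
    · rw [hAl]
      exact isMonotone_A₁ Q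
    · rw [hAc]
      exact isMonotone_B f i
  · refine Fin.lastCases ?_ (fun i => ?_) i
    · rw [hAl]
      exact ⟨_, smul_sub_proj_mem_A₁ hQne hQcl hQcv hP₁ hγ0 x⟩
    · rw [hAc]
      exact exists_resolvent_B hfcv hflsc hγ0 i x
  · refine Fin.lastCases ?_ (fun i => ?_) i
    · rw [hAl, if_neg hlast, smul_zero, sub_zero, hz.last]
      exact smul_sub_proj_mem_A₁ hQne hQcl hQcv hP₁ hγ0
        ((2 : ℝ) • zb k (Fin.last N) - z k (Fin.last N))
    · rw [hAc]
      by_cases hi : i.val = 0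
      · have hi0 : i.castSucc = 0 := Fin.ext hi
        rw [hz.first k i hi, pair_reflection_sub_smul_pair, if_pos hi0, ← hi0]
        exact res_spec hγ0 (exists_resolvent_B hfcv hflsc hγ0 i _)
      · have hi0 : i.castSucc ≠ 0 := fun h0 => hi (congrArg Fin.val h0)
        rw [hz.middle k i hi, if_neg hi0, smul_zero, sub_zero]
        exact res_spec hγ0 (exists_resolvent_B hfcv hflsc hγ0 i _)

/-- Stated for any closed convex P, so that `P₂` and `P₃` are both instances; nonemptiness of P
comes from the assumed solution. -/
theorem convergenceP (hN : 1 ≤ N) {Q : Set H} (hQne : Q.Nonempty) (hQcl : IsClosed Q)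
    (hQcv : Convex ℝ Q) {h : H → ℝ} (hcv : ConvexOn ℝ Set.univ h) (hdiff : Differentiable ℝ h)
    {β : ℝ} (hβ : 0 < β) (hlip : ∀ x y, ‖gradient h x - gradient h y‖ ≤ β⁻¹ * ‖x - y‖)
    {f : Fin N → H → ℝ} (hfcv : ∀ i, ConvexOn ℝ Set.univ (f i))
    (hflsc : ∀ i, LowerSemicontinuous (f i)) {γ : ℝ} (hγ : γ ∈ Set.Ioo 0 (2 * β))
    {P : Set (EuclideanSpace ℝ (Fin N))} (hPcl : IsClosed P) (hPcv : Convex ℝ P)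
    (hsol : ∃ z, IsSolP h f Q P z) {z zb zt : ℕ → ProdSpace H N (N + 2)}
    (hz : IsDavisYinP h f Q P γ z zb zt) : ∃ zs, IsSolP h f Q P zs ∧ WeakTendsto zb zs := by
  have hγ0 := hγ.1
  let A : Fin (N + 2) → Block H N → Set (Block H N) :=
    Fin.snoc (Fin.snoc (fun i => B f i) (A₁ Q) : Fin (N + 1) → Block H N → Set (Block H N)) (AP P)
  have hAc : ∀ i : Fin N, A i.castSucc.castSucc = B f i := fun i => by
    simp only [A, Fin.snoc_castSucc]
  have hAl : A (Fin.last N).castSucc = A₁ Q := by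
    simp only [A, Fin.snoc_castSucc, Fin.snoc_last]
  have hAP : A (Fin.last (N + 1)) = AP P := by simp only [A, Fin.snoc_last]
  have hprod : ∀ x : ProdSpace H N (N + 2), prodAP f Q P x = {w | ∀ i, w i ∈ A i (x i)} := by
    intro x
    ext w
    change _ ∧ _ ∧ _ ↔ ∀ i, _
    rw [Fin.forall_fin_succ', Fin.forall_fin_succ', hAl, hAP, and_assoc]
    simp only [hAc]
  have hiff : ∀ x : ProdSpace H N (N + 2), IsSolP h f Q P x ↔
      0 ∈ {w : ProdSpace H N (N + 2) | ∀ i, w i ∈ A i (x i)}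
        + {WithLp.toLp 2 fun i => if i = 0 then pair (gradient h (x 0).fst) 0 else 0}
        + normalCone (diagSubmodule (Block H N) (N + 2) : Set _) x := by
    intro x
    rw [← hprod]
    rfl
  obtain ⟨hP₁, hPne⟩ : (P₁ N).Nonempty ∧ P.Nonempty := by
    obtain ⟨x, hx⟩ := hsol
    obtain ⟨-, a, ha, -⟩ :=
      zero_mem_add_normalCone_iff (V := diagSubmodule (Block H N) (N + 2)).1 hx
    exact ⟨⟨_, ha.2.1.2.1⟩, ⟨_, ha.2.2.2.1⟩⟩
  have hlast : (Fin.last N).castSucc ≠ 0 := fun h0 => by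
    have := congrArg Fin.val h0
    simp at this
    omega
  have hlast' : Fin.last (N + 1) ≠ 0 := Fin.last_pos.ne'
  -- With m = N + 1, the weight 1/(m + 1) of the block theorem is the weight 1/(N + 2) of the
  -- routine.
  have havg : ∀ k i, zb k i = (1 / (((N + 1 : ℕ) : ℝ) + 1)) • ∑ j, z k j := by
    intro k i
    rw [hz.average]
    congr 2
    push_cast
    ring
  simp only [hiff] at hsol ⊢
  refine exists_weak_limit_block_davisYin (c := fun x => pair (gradient h x.fst) 0)
    (z := z) (zt := zt) (fun i => ?_) hβ hγ (pair_gradient_cocoercive hcv hdiff hβ hlip)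
    (fun i x => ?_) hsol havg (fun k i => ?_) hz.update
  · refine Fin.lastCases ?_ (Fin.lastCases ?_ (fun i => ?_)) i
    · rw [hAP]
      exact isMonotone_AP P
    · rw [hAl]
      exact isMonotone_A₁ Q
    · rw [hAc]
      exact isMonotone_B f i
  · refine Fin.lastCases ?_ (Fin.lastCases ?_ (fun i => ?_)) i
    · rw [hAP]
      exact ⟨_, smul_sub_proj_mem_AP hPne hPcl hPcv hγ0 x⟩
    · rw [hAl]
      exact ⟨_, smul_sub_proj_mem_A₁ hQne hQcl hQcv hP₁ hγ0 x⟩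
    · rw [hAc]
      exact exists_resolvent_B hfcv hflsc hγ0 i x
  · refine Fin.lastCases ?_ (Fin.lastCases ?_ (fun i => ?_)) i
    · rw [hAP, if_neg hlast', smul_zero, sub_zero, hz.last]
      exact smul_sub_proj_mem_AP hPne hPcl hPcv hγ0
        ((2 : ℝ) • zb k (Fin.last (N + 1)) - z k (Fin.last (N + 1)))
    · rw [hAl, if_neg hlast, smul_zero, sub_zero, hz.penultimate]
      exact smul_sub_proj_mem_A₁ hQne hQcl hQcv hP₁ hγ0
        ((2 : ℝ) • zb k (Fin.last N).castSucc - z k (Fin.last N).castSucc)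
    · rw [hAc]
      by_cases hi : i.val = 0
      · have hi0 : i.castSucc.castSucc = 0 := Fin.ext hi
        rw [hz.first k i hi, pair_reflection_sub_smul_pair, if_pos hi0, ← hi0]
        exact res_spec hγ0 (exists_resolvent_B hfcv hflsc hγ0 i _)
      · have hi0 : i.castSucc.castSucc ≠ 0 := fun h0 => hi (congrArg Fin.val h0)
        rw [hz.middle k i hi, if_neg hi0, smul_zero, sub_zero]
        exact res_spec hγ0 (exists_resolvent_B hfcv hflsc hγ0 i _)

theorem isClosed_P₂ (q : Fin N → ℝ) : IsClosed (P₂ q) := by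
  simp only [P₂, Set.ofPred_forall]
  exact isClosed_iInter fun i => isClosed_le (by fun_prop) continuous_const

theorem convex_P₂ (q : Fin N → ℝ) : Convex ℝ (P₂ q) := by
  simp only [P₂, Set.ofPred_forall]
  exact convex_iInter fun i => convex_halfSpace_le ⟨fun _ _ => rfl, fun _ _ => rfl⟩ _

theorem isClosed_P₃ (ξ : Fin N → ℝ) (μm μp : ℝ) : IsClosed (P₃ ξ μm μp) := by
  have hc : Continuous fun p : EuclideanSpace ℝ (Fin N) => ∑ i, p i * ξ i := by fun_prop
  exact (isClosed_le continuous_const hc).inter (isClosed_le hc continuous_const)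

theorem convex_P₃ (ξ : Fin N → ℝ) (μm μp : ℝ) : Convex ℝ (P₃ ξ μm μp) := by
  have hlin : IsLinearMap ℝ fun p : EuclideanSpace ℝ (Fin N) => ∑ i, p i * ξ i :=
    ⟨fun x y => by simp [Finset.sum_add_distrib, add_mul],
      fun c x => by simp [Finset.mul_sum, mul_assoc]⟩
  exact (convex_halfSpace_ge hlin _).inter (convex_halfSpace_le hlin _)

end Routines

end DRO

theorem mainTheorem12
    {H : Type*} [NormedAddCommGroup H] [InnerProductSpace ℝ H] [CompleteSpace H]
    {N : ℕ} (hN : 1 ≤ N)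
    (Q : Set H) (hQne : Q.Nonempty) (hQcl : IsClosed Q) (hQcv : Convex ℝ Q)
    (h : H → ℝ) (hcv : ConvexOn ℝ Set.univ h) (hdiff : Differentiable ℝ h)
    (β : ℝ) (hβ : 0 < β)
    (hlip : ∀ x y, ‖gradient h x - gradient h y‖ ≤ β⁻¹ * ‖x - y‖)
    (f : Fin N → H → ℝ) (hfcv : ∀ i, ConvexOn ℝ Set.univ (f i))
    (hflsc : ∀ i, LowerSemicontinuous (f i))
    (γ : ℝ) (hγ : γ ∈ Set.Ioo 0 (2 * β)) :
    ((∃ z, DRO.IsSol₁ h f Q z) →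
      ∀ z zb zt : ℕ → DRO.ProdSpace H N (N + 1), DRO.IsDavisYin₁ h f Q γ z zb zt →
        ∃ zs, DRO.IsSol₁ h f Q zs ∧ DRO.WeakTendsto zb zs) ∧
    (∀ q : Fin N → ℝ, (∃ z, DRO.IsSolP h f Q (DRO.P₂ q) z) →
      ∀ z zb zt : ℕ → DRO.ProdSpace H N (N + 2), DRO.IsDavisYinP h f Q (DRO.P₂ q) γ z zb zt →
        ∃ zs, DRO.IsSolP h f Q (DRO.P₂ q) zs ∧ DRO.WeakTendsto zb zs) ∧
    (∀ (ξ : Fin N → ℝ) (μm μp : ℝ), (∃ z, DRO.IsSolP h f Q (DRO.P₃ ξ μm μp) z) →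
      ∀ z zb zt : ℕ → DRO.ProdSpace H N (N + 2),
        DRO.IsDavisYinP h f Q (DRO.P₃ ξ μm μp) γ z zb zt →
        ∃ zs, DRO.IsSolP h f Q (DRO.P₃ ξ μm μp) zs ∧ DRO.WeakTendsto zb zs) :=
  ⟨fun hsol _ _ _ hz =>
      DRO.convergence₁ hN hQne hQcl hQcv hcv hdiff hβ hlip hfcv hflsc hγ hsol hz,
    fun q hsol _ _ _ hz =>
      DRO.convergenceP hN hQne hQcl hQcv hcv hdiff hβ hlip hfcv hflsc hγ (DRO.isClosed_P₂ q)
        (DRO.convex_P₂ q) hsol hz,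
    fun ξ μm μp hsol _ _ _ hz =>
      DRO.convergenceP hN hQne hQcl hQcv hcv hdiff hβ hlip hfcv hflsc hγ
        (DRO.isClosed_P₃ ξ μm μp) (DRO.convex_P₃ ξ μm μp) hsol hz⟩
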